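/- Let $M$ be a finite matroid with ground set $E(M)$, let $k$ be a field, and let $S=k[x_e : e\in E(M)]$ with its standard grading. The facet ideal $\mathcal F(M)\subset S$ is the ideal generated by the monomials $\prod_{e\in\sigma}x_e$ for $\sigma$ a basis of $M$. Let $B_1,\dots,B_t$ be the (distinct) blocks of $M$, i.e. the equivalence classes of the relation on $E(M)$ that relates $e$ and $f$ if $e=f$ or some circuit of $M$ contains both $e$ and $f$. Regard each $B_j$ as the restriction of $M$ to $B_j$, and let $S\mathcal F(B_j)$ be the ideal of $S$ generated by $\mathcal F(B_j)\subset k[x_e : e\in B_j]$. For each $1\le j\le t$, let $$F_j:\quad 0\leftarrow S(-r_j)^{n_{0,j}}\leftarrow S(-(r_j+1))^{n_{1,j}}\leftarrow\cdots\leftarrow S(-(r_j+l_j))^{n_{l_j,j}}\leftarrow 0$$ be a (linear) $\mathbb N$-graded minimal free resolution of $S\mathcal F(B_j)$: the maps preserve degrees, the image of each map $F_{j,u+1}\to F_{j,u}$ lies in $\langle x_e : e\in E(M)\rangle F_{j,u}$, and the complex is exact except at $F_{j,0}$, where the cokernel of $F_{j,1}\to F_{j,0}$ is isomorphic to $S\mathcal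 F(B_j)$ as a graded module. Put $$r=\sum_{j=1}^t r_j,\qquad l=\sum_{j=1}^t l_j,\qquad \beta_i=\sum_{u_1+\cdots+u_t=i}n_{u_1,1}n_{u_2,2}\cdots n_{u_t,t}\quad(i\ge 0),$$ where $n_{u,j}=0$ for $u>l_j$. Then the tensor product of complexes $F_1\otimes_S\cdots\otimes_S F_t$ has the form $$0\leftarrow S(-r)^{\beta_0}\leftarrow S(-(r+1))^{\beta_1}\leftarrow\cdots\leftarrow S(-(r+l))^{\beta_l}\leftarrow 0$$ and is an $\mathbb N$-graded minimal free resolution of $\mathcal F(M)$. In particular, $\mathcal F(M)$ has a linear minimal free resolution of this form. If $n_{l_j,j}\neq 0$ for all $j$, then $\beta_l\neq 0$. (For $t=0$, i.e. $E(M)=\emptyset$, the tensor product is $S$ in degree $0$.) -/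

import Mathlib

namespace MatroidFacet

open MvPolynomial

/-! ### Blocks and facet ideals of matroids -/

/-- The relation `e ξ f` on the ground set: `e = f`, or some circuit contains both. -/
def BlockRel {α : Type*} (M : Matroid α) (e f : α) : Prop :=
  e = f ∨ ∃ C, M.IsCircuit C ∧ e ∈ C ∧ f ∈ C

/-- A block (connected component) of `M` is a class of the relation `ξ` on the ground set. -/
def IsBlock {α : Type*} (M : Matroid α) (B : Set α) : Prop :=
  ∃ e ∈ M.E, B = {f ∈ M.E | BlockRel M e f}

theorem IsBlock.subset_ground {α : Type*} {M : Matroid α} {B : Set α} (h : IsBlock M B) :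
    B ⊆ M.E := by
  obtain ⟨e, -, rfl⟩ := h
  exact fun f hf => hf.1

/-- The facet ideal of a finite matroid `N`, in the polynomial ring with one variable for each
element of the ground set: it is generated by the monomials `x^σ`, `σ` a basis (a maximal
independent set) of `N`. -/
noncomputable def facetIdeal (k : Type*) [Field k] {α : Type*} (N : Matroid α) :
    Ideal (MvPolynomial N.E k) :=
  Ideal.span {f | ∃ σ : Finset N.E, N.IsBase ((fun e : N.E => (e : α)) '' (σ : Set N.E)) ∧
    f = ∏ e ∈ σ, X e}

/-- The ideal `S I` of `S = k[x_e : e ∈ Y]` generated by an ideal `I` of `k[x_e : e ∈ X]`,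
where `X ⊆ Y`. -/
noncomputable def extendIdeal {k : Type*} [Field k] {α : Type*} {A B : Set α} (h : A ⊆ B)
    (I : Ideal (MvPolynomial A k)) : Ideal (MvPolynomial B k) :=
  I.map (rename (Set.inclusion h) : MvPolynomial A k →ₐ[k] MvPolynomial B k)

/-- `S · F(B)` for a subset `B` of the ground set of `M`, where `B` also denotes the restriction
of `M` to `B`, and `S = k[x_e : e ∈ E(M)]`. -/
noncomputable def blockIdeal (k : Type*) [Field k] {α : Type*} (M : Matroid α) {B : Set α}
    (h : B ⊆ M.E) : Ideal (MvPolynomial M.E k) :=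
  extendIdeal (A := B) h (facetIdeal k (M.restrict B))

/-! ### Graded free complexes and resolutions over a polynomial ring -/

/-- A sequence `F_0 ← F_1 ← F_2 ← ⋯` of finite graded free modules with chosen homogeneous bases
over `S = k[x_s : s ∈ σ]`, the maps being given by matrices. The module `F_u = ⨁_b S(-deg b)` has
basis `gens u`, and is the module of functions `gens u → S`. -/
structure GradedFreeSeq (σ k : Type*) [Field k] where
  /-- the basis of `F_u` -/
  gens : ℕ → Type
  /-- `F_u` has finite rank -/
  fin : ∀ u, Fintype (gens u)
  /-- the degrees of the basis elements of `F_u` -/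
  deg : ∀ u, gens u → ℕ
  /-- the matrix of the map `F_{u+1} → F_u` -/
  mat : ∀ u, Matrix (gens u) (gens (u + 1)) (MvPolynomial σ k)

attribute [instance] GradedFreeSeq.fin

/-- The homogeneous elements of degree `m` of `⨁_b S(-deg b)`: every monomial in the coordinate
at `b` has degree `m - deg b`. -/
def IsHomogeneousVec {σ k : Type*} [Field k] {ι : Type} (deg : ι → ℕ) (m : ℕ)
    (v : ι → MvPolynomial σ k) : Prop :=
  ∀ b, ∀ s ∈ (v b).support, s.degree + deg b = m

namespace GradedFreeSeq

variable {σ k : Type*} [Field k]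

/-- The map `F_{u+1} → F_u`. -/
noncomputable def d (F : GradedFreeSeq σ k) (u : ℕ) :
    (F.gens (u + 1) → MvPolynomial σ k) →ₗ[MvPolynomial σ k] (F.gens u → MvPolynomial σ k) :=
  (F.mat u).mulVecLin

/-- `F` is an `ℕ`-graded minimal free resolution of the (homogeneous) ideal `I` of `S`. -/
structure IsMinimalGradedResolution (F : GradedFreeSeq σ k) (I : Ideal (MvPolynomial σ k)) :
    Prop where
  /-- the boundary maps are degree-preserving -/
  degree_preserving : ∀ u m v, IsHomogeneousVec (F.deg (u + 1)) m v →
    IsHomogeneousVec (F.deg u) m (F.d u v)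
  /-- minimality: the image of each boundary map lies in `⟨x_s : s ∈ σ⟩ F_u` -/
  minimal : ∀ u, LinearMap.range (F.d u) ≤
    Ideal.span (Set.range (X : σ → MvPolynomial σ k)) •
      (⊤ : Submodule (MvPolynomial σ k) (F.gens u → MvPolynomial σ k))
  /-- the sequence is a complex, and exact, at `F_{u+1}` -/
  exact : ∀ u, LinearMap.range (F.d (u + 1)) = LinearMap.ker (F.d u)
  /-- the cokernel of `F_1 → F_0` is isomorphic to `I` as a graded module -/
  augmentation : ∃ ε : (F.gens 0 → MvPolynomial σ k) →ₗ[MvPolynomial σ k] MvPolynomial σ k,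
    (∀ m v, IsHomogeneousVec (F.deg 0) m v → (ε v).IsHomogeneous m) ∧
    LinearMap.range ε = I ∧ LinearMap.ker ε = LinearMap.range (F.d 0)

/-- `F` has the linear shape
`0 ← S(-r)^{n_0} ← S(-(r+1))^{n_1} ← ⋯ ← S(-(r+l))^{n_l} ← 0`. -/
structure HasLinearShape (F : GradedFreeSeq σ k) (r l : ℕ) (n : ℕ → ℕ) : Prop where
  rank_eq : ∀ u, Fintype.card (F.gens u) = n u
  deg_eq : ∀ u b, F.deg u b = r + u
  rank_zero : ∀ u, l < u → n u = 0

open Classical in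
/-- The matrix entry, at `b` and `c`, of the boundary map of `⨁_u F_u`: the coefficient of the
basis element `b` in the boundary of the basis element `c`. -/
noncomputable def entry (F : GradedFreeSeq σ k) (b c : Σ u, F.gens u) : MvPolynomial σ k :=
  if h : c.1 = b.1 + 1 then F.mat b.1 b.2 (h ▸ c.2) else 0

open Classical in
/-- The tensor product `F_1 ⊗_S ⋯ ⊗_S F_t` of complexes. In homological degree `i` it is
`⨁_{u_1 + ⋯ + u_t = i} F_{1,u_1} ⊗ ⋯ ⊗ F_{t,u_t}`, whose basis consists of the tensors
`b_1 ⊗ ⋯ ⊗ b_t` of basis elements `b_j` of `F_{j,u_j}`, in degree `∑ deg b_j`. The boundary map is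
`b_1 ⊗ ⋯ ⊗ b_t ↦ ∑_j (-1)^{u_1 + ⋯ + u_{j-1}} b_1 ⊗ ⋯ ⊗ d b_j ⊗ ⋯ ⊗ b_t`. -/
noncomputable def tensor {t : ℕ} (F : Fin t → GradedFreeSeq σ k) : GradedFreeSeq σ k where
  gens i := (u : ↥(Finset.piAntidiag (Finset.univ : Finset (Fin t)) i)) ×
    (∀ j, (F j).gens (u.1 j))
  fin _ := inferInstance
  deg _ b := ∑ j, (F j).deg (b.1.1 j) (b.2 j)
  mat _ b c := ∑ j,
    if ∀ a, a ≠ j →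
        (⟨b.1.1 a, b.2 a⟩ : Σ u, (F a).gens u) = ⟨c.1.1 a, c.2 a⟩ then
      (-1) ^ (∑ a ∈ Finset.univ.filter (fun a => a < j), c.1.1 a) *
        (F j).entry ⟨b.1.1 j, b.2 j⟩ ⟨c.1.1 j, c.2 j⟩
    else 0

end GradedFreeSeq

end MatroidFacet

namespace MatroidFacet

open Matrix

/-! ### Augmented acyclic complexes given by one square matrix -/

section Complexes

variable {S X Y : Type*} [CommRing S]

open Classical in
/-- The part of a vector in the homological degrees satisfying `p`. -/
noncomputable def truncate (R : Type*) [CommRing R] [Algebra R S] (deg : X → ℕ) (p : ℕ → Prop) :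
    (X → S) →ₗ[R] (X → S) where
  toFun v x := if p (deg x) then v x else 0
  map_add' v w := by ext x; by_cases h : p (deg x) <;> simp [h]
  map_smul' a v := by ext x; by_cases h : p (deg x) <;> simp [h]

open Classical in
theorem truncate_apply (R : Type*) [CommRing R] [Algebra R S] (deg : X → ℕ) (p : ℕ → Prop)
    (v : X → S) (x : X) : truncate R deg p v x = if p (deg x) then v x else 0 := rfl

variable [Fintype X] [Fintype Y]

/-- A free resolution `⋯ → F_1 → F_0 → S` of the ideal generated by the entries of `ε`, written on
the basis `X` of `⨁ F_u`, where `deg` is the homological degree and `D` is the total boundary. -/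
structure IsFreeResolution (deg : X → ℕ) (D : Matrix X X S) (ε : X → S) : Prop where
  mat_deg : ∀ x y, D x y ≠ 0 → deg y = deg x + 1
  aug_deg : ∀ x, ε x ≠ 0 → deg x = 0
  mat_mulVec : ∀ v, D *ᵥ (D *ᵥ v) = 0
  aug_mulVec : ∀ v, ε ⬝ᵥ (D *ᵥ v) = 0
  exact : ∀ v, D *ᵥ v = 0 → ε ⬝ᵥ v = 0 → ∃ w, D *ᵥ w = v

namespace IsFreeResolution

variable {deg : X → ℕ} {D : Matrix X X S} {ε : X → S}

theorem mulVec_truncate (h : IsFreeResolution deg D ε) (R : Type*) [CommRing R] [Algebra R S]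
    (p : ℕ → Prop) (v : X → S) :
    D *ᵥ truncate R deg p v = truncate R deg (fun q => p (q + 1)) (D *ᵥ v) := by
  classical
  ext x
  rw [truncate_apply, mulVec, dotProduct, mulVec, dotProduct]
  split_ifs with hp
  · refine Finset.sum_congr rfl fun y _ => ?_
    by_cases hD : D x y = 0
    · simp [hD]
    · rw [truncate_apply, h.mat_deg x y hD, if_pos hp]
  · refine Finset.sum_eq_zero fun y _ => ?_
    by_cases hD : D x y = 0
    · simp [hD]
    · rw [truncate_apply, h.mat_deg x y hD, if_neg hp, mul_zero]

open Classical in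
theorem dotProduct_truncate (h : IsFreeResolution deg D ε) (R : Type*) [CommRing R] [Algebra R S]
    (p : ℕ → Prop) (v : X → S) :
    ε ⬝ᵥ truncate R deg p v = if p 0 then ε ⬝ᵥ v else 0 := by
  rw [dotProduct, dotProduct]
  split_ifs with hp
  · refine Finset.sum_congr rfl fun y _ => ?_
    by_cases hD : ε y = 0
    · simp [hD]
    · rw [truncate_apply, h.aug_deg y hD, if_pos hp]
  · refine Finset.sum_eq_zero fun y _ => ?_
    by_cases hD : ε y = 0
    · simp [hD]
    · rw [truncate_apply, h.aug_deg y hD, if_neg hp, mul_zero]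

/-- A cycle is the boundary of a chain with augmentation `0`. -/
theorem exact_of_aug_eq_zero (h : IsFreeResolution deg D ε) (v : X → S) (hv : D *ᵥ v = 0)
    (hv' : ε ⬝ᵥ v = 0) : ∃ w, D *ᵥ w = v ∧ ε ⬝ᵥ w = 0 := by
  obtain ⟨w, hw⟩ := h.exact v hv hv'
  refine ⟨truncate S deg (fun q => q ≠ 0) w, ?_, ?_⟩
  · rw [h.mulVec_truncate, hw]
    ext x
    simp [truncate_apply]
  · rw [h.dotProduct_truncate]
    simp

theorem exists_lift (h : IsFreeResolution deg D ε) {R M : Type*} [CommRing R] [Algebra R S]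
    [AddCommGroup M] [Module R M] [Module.Projective R M] (p : M →ₗ[R] (X → S))
    (hp : ∀ m, D *ᵥ p m = 0) (hp' : ∀ m, ε ⬝ᵥ p m = 0) :
    ∃ g : M →ₗ[R] (X → S), ∀ m, D *ᵥ g m = p m := by
  let d : (X → S) →ₗ[R] (X → S) := D.mulVecLin.restrictScalars R
  have hd : ∀ m, p m ∈ LinearMap.range d := fun m => by
    obtain ⟨w, hw⟩ := h.exact (p m) (hp m) (hp' m)
    exact ⟨w, hw⟩
  obtain ⟨g, hg⟩ := Module.projective_lifting_property d.rangeRestrict (p.codRestrict _ hd)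
    d.surjective_rangeRestrict
  exact ⟨g, fun m => congrArg Subtype.val (LinearMap.congr_fun hg m)⟩

/-- If the resolved ideal is an `R`-linear direct summand of the `R`-projective algebra `S`, then
the resolution is `R`-linearly split. -/
theorem exists_section (h : IsFreeResolution deg D ε) {R : Type*} [CommRing R] [Algebra R S]
    [Module.Projective R S] (ρ : S →ₗ[R] S) (hρ : ∀ f, ρ f ∈ Ideal.span (Set.range ε))
    (hρ' : ∀ f ∈ Ideal.span (Set.range ε), ρ f = f) :
    ∃ g : (X → S) →ₗ[R] (X → S), ∀ u, D *ᵥ u = 0 → ε ⬝ᵥ u = 0 → D *ᵥ g u = u := by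
  classical
  have : Module.Projective R (X → S) :=
    Module.Projective.of_equiv (DirectSum.linearEquivFunOnFintype R X fun _ => S)
  let d : (X → S) →ₗ[R] (X → S) := D.mulVecLin.restrictScalars R
  have d_apply : ∀ v, d v = D *ᵥ v := fun _ => rfl
  let e : (X → S) →ₗ[R] S := (Fintype.linearCombination S ε).restrictScalars R
  have e_apply : ∀ v, e v = ε ⬝ᵥ v := fun v => by
    simp [e, Fintype.linearCombination_apply, dotProduct, mul_comm]
  have mem_range : ∀ f, f ∈ LinearMap.range e ↔ f ∈ Ideal.span (Set.range ε) := fun f => by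
    rw [Ideal.mem_span_range_iff_exists_fun]
    rfl
  obtain ⟨s₀, hs₀⟩ := Module.projective_lifting_property e.rangeRestrict
    (ρ.codRestrict (LinearMap.range e) fun f => (mem_range _).2 (hρ f)) e.surjective_rangeRestrict
  have hs₀' : ∀ f, e (s₀ f) = ρ f := fun f => congrArg Subtype.val (LinearMap.congr_fun hs₀ f)
  let s : S →ₗ[R] (X → S) := truncate R deg (fun q => q = 0) ∘ₗ s₀
  have hes : ∀ v, e (s (e v)) = e v := fun v => by
    have : e (s (e v)) = e (s₀ (e v)) := by
      simp [s, e_apply, h.dotProduct_truncate]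
    rw [this, hs₀', hρ' _ ((mem_range _).1 ⟨v, rfl⟩)]
  have hds : ∀ f, d (s f) = 0 := fun f => by
    ext x
    simp [s, d_apply, h.mulVec_truncate, truncate_apply]
  have hdd : ∀ v, d (d v) = 0 := h.mat_mulVec
  have hed : ∀ v, e (d v) = 0 := fun v => by rw [e_apply]; exact h.aug_mulVec v
  have key : ∀ q : ℕ, ∃ g : (X → S) →ₗ[R] (X → S), (∀ u, e (g u) = 0) ∧
      ∀ u, d u = 0 → e u = 0 → (∀ x, q ≤ deg x → u x = 0) → d (g u) = u := by
    intro q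
    induction q with
    | zero => exact ⟨0, by simp, fun u _ _ hu => by ext x; simp [hu x]⟩
    | succ q ih =>
      obtain ⟨g, hg, hg'⟩ := ih
      let P := truncate (S := S) R deg (fun i => i = q)
      let p : (X → S) →ₗ[R] (X → S) := P - g ∘ₗ d ∘ₗ P - s ∘ₗ e ∘ₗ P
      have p_apply : ∀ v, p v = P v - g (d (P v)) - s (e (P v)) := fun v => rfl
      have hdP : ∀ v, d (g (d (P v))) = d (P v) := fun v => by
        refine hg' _ (hdd _) (hed _) fun x hx => ?_
        rw [d_apply, h.mulVec_truncate, truncate_apply, if_neg (by omega)]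
      obtain ⟨g', hg''⟩ := h.exists_lift p
        (fun v => by rw [← d_apply, p_apply, map_sub, map_sub, hdP, hds]; simp)
        (fun v => by rw [← e_apply, p_apply, map_sub, map_sub, hg, hes]; simp)
      refine ⟨g ∘ₗ truncate R deg (fun i => i < q) + truncate R deg (fun i => i ≠ 0) ∘ₗ g',
        fun u => ?_, fun u hu hu' hq => ?_⟩
      · rw [LinearMap.add_apply, map_add, LinearMap.comp_apply, hg, LinearMap.comp_apply,
          e_apply, h.dotProduct_truncate]
        simp
      · have hdt : ∀ t : ℕ → Prop, d (truncate R deg t u) = 0 := fun t => by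
          rw [d_apply, h.mulVec_truncate, ← d_apply, hu, map_zero]
        have het : ∀ t : ℕ → Prop, e (truncate R deg t u) = 0 := fun t => by
          rw [e_apply, h.dotProduct_truncate, ← e_apply, hu', ite_self]
        rw [LinearMap.add_apply, map_add, LinearMap.comp_apply, LinearMap.comp_apply,
          hg' _ (hdt _) (het _) fun x hx => by rw [truncate_apply, if_neg (by omega)]]
        have : d (truncate R deg (fun i => i ≠ 0) (g' u)) = P u := by
          have hp : p u = P u := by
            rw [p_apply, hdt, het, map_zero, map_zero, sub_zero, sub_zero]
          rw [d_apply, h.mulVec_truncate, hg'', hp]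
          ext x
          simp [truncate_apply]
        rw [this]
        ext x
        simp only [Pi.add_apply, truncate_apply, P]
        rcases lt_trichotomy (deg x) q with hx | hx | hx
        · simp [hx, hx.ne]
        · simp [hx]
        · simp [hx.not_gt, hx.ne', hq x hx]
  obtain ⟨g, -, hg⟩ := key (Finset.univ.sup deg + 1)
  exact ⟨g, fun u hu hu' => hg u hu (by rw [e_apply, hu']) fun x hx =>
    absurd (Finset.le_sup (f := deg) (Finset.mem_univ x)) (by omega)⟩

/-- The splitting yields `ker ∩ J F = d (J F)` for ideals `J` that come from `R`. -/
theorem exact_of_ideal (h : IsFreeResolution deg D ε) {R : Type*} [CommRing R] [Algebra R S]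
    [Module.Projective R S] (ρ : S →ₗ[R] S) (hρ : ∀ f, ρ f ∈ Ideal.span (Set.range ε))
    (hρ' : ∀ f ∈ Ideal.span (Set.range ε), ρ f = f) (T : Set R) (u : X → S)
    (hu : D *ᵥ u = 0) (hu' : ε ⬝ᵥ u = 0)
    (hJ : ∀ x, u x ∈ Ideal.span (algebraMap R S '' T)) :
    ∃ w, D *ᵥ w = u ∧ ∀ x, w x ∈ Ideal.span (algebraMap R S '' T) := by
  classical
  obtain ⟨g, hg⟩ := h.exists_section ρ hρ hρ'
  refine ⟨g u, hg u hu hu', ?_⟩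
  have key : ∀ f ∈ Ideal.span (algebraMap R S '' T), ∀ (s : S) (y x : X),
      g (Pi.single y (s * f)) x ∈ Ideal.span (algebraMap R S '' T) := by
    intro f hf
    refine Submodule.span_induction ?_ ?_ ?_ ?_ hf
    · rintro _ ⟨r, hr, rfl⟩ s y x
      have : Pi.single y (s * algebraMap R S r) = r • (Pi.single y s : X → S) := by
        rw [← Pi.single_smul, Algebra.smul_def, mul_comm]
      rw [this, map_smul, Pi.smul_apply, Algebra.smul_def]
      exact Ideal.mul_mem_right _ _ (Ideal.subset_span ⟨r, hr, rfl⟩)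
    · simp
    · intro a b _ _ ha hb s y x
      rw [mul_add, Pi.single_add, map_add]
      exact add_mem (ha s y x) (hb s y x)
    · intro a b _ hb s y x
      rw [smul_eq_mul, ← mul_assoc]
      exact hb _ y x
  intro x
  have : u = ∑ y, Pi.single y (1 * u y) := by
    ext x
    simp
  rw [this, map_sum, Finset.sum_apply]
  exact sum_mem fun y _ => key _ (hJ y) 1 y x

end IsFreeResolution

/-! ### The tensor product of two complexes -/

open Classical in
/-- The boundary of the tensor product of two complexes. -/
noncomputable def tensorMat (deg : X → ℕ) (D : Matrix X X S) (E : Matrix Y Y S) :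
    Matrix (X × Y) (X × Y) S :=
  fun p q => (if p.2 = q.2 then D p.1 q.1 else 0) +
    (if p.1 = q.1 then (-1) ^ deg q.1 * E p.2 q.2 else 0)

theorem tensorMat_mulVec (deg : X → ℕ) (D : Matrix X X S) (E : Matrix Y Y S) (v : X × Y → S)
    (x : X) (y : Y) : (tensorMat deg D E *ᵥ v) (x, y) =
      (D *ᵥ fun x' => v (x', y)) x + (-1) ^ deg x * (E *ᵥ fun y' => v (x, y')) y := by
  classical
  simp only [mulVec, dotProduct, tensorMat, add_mul, Finset.sum_add_distrib, Fintype.sum_prod_type,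
    ite_mul, zero_mul]
  congr 1
  · simp
  · rw [Finset.sum_comm]
    simp [Finset.mul_sum, mul_assoc]

theorem dotProduct_tensor (ε : X → S) (η : Y → S) (v : X × Y → S) :
    (fun p : X × Y => ε p.1 * η p.2) ⬝ᵥ v = ε ⬝ᵥ fun x => η ⬝ᵥ fun y => v (x, y) := by
  simp only [dotProduct, Fintype.sum_prod_type, Finset.mul_sum, mul_assoc]

theorem dotProduct_mulVec_comm (D : Matrix X X S) (η : Y → S) (v : X × Y → S) (x : X) :
    (η ⬝ᵥ fun y => (D *ᵥ fun x' => v (x', y)) x) = (D *ᵥ fun x' => η ⬝ᵥ fun y => v (x', y)) x := by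
  simp only [dotProduct, mulVec, Finset.mul_sum]
  rw [Finset.sum_comm]
  exact Finset.sum_congr rfl fun _ _ => Finset.sum_congr rfl fun _ _ => by ring

theorem mulVec_mulVec_comm (D : Matrix X X S) (E : Matrix Y Y S) (v : X × Y → S) (x : X) (y : Y) :
    (E *ᵥ fun y' => (D *ᵥ fun x' => v (x', y')) x) y =
      (D *ᵥ fun x' => (E *ᵥ fun y' => v (x', y')) y) x :=
  dotProduct_mulVec_comm D (E y) v x

/-- The tensor product of resolutions of `I` and `J` is a resolution of `I J` as soon as the first
resolution stays exact after tensoring with `J`. -/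
theorem IsFreeResolution.tensor {deg : X → ℕ} {D : Matrix X X S} {ε : X → S}
    (h : IsFreeResolution deg D ε) {deg' : Y → ℕ} {E : Matrix Y Y S} {η : Y → S}
    (h' : IsFreeResolution deg' E η)
    (hJ : ∀ u : X → S, D *ᵥ u = 0 → ε ⬝ᵥ u = 0 → (∀ x, u x ∈ Ideal.span (Set.range η)) →
      ∃ w, D *ᵥ w = u ∧ ∀ x, w x ∈ Ideal.span (Set.range η)) :
    IsFreeResolution (fun p : X × Y => deg p.1 + deg' p.2) (tensorMat deg D E)
      (fun p => ε p.1 * η p.2) := by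
  classical
  have hsgn : ∀ n : ℕ, ((-1 : S) ^ n) * (-1) ^ n = 1 := fun n => by rw [← mul_pow]; simp
  have aug_tensor : ∀ v x, (η ⬝ᵥ fun y => (tensorMat deg D E *ᵥ v) (x, y)) =
      (D *ᵥ fun x' => η ⬝ᵥ fun y => v (x', y)) x := fun v x => by
    simp only [tensorMat_mulVec]
    rw [← dotProduct_mulVec_comm, ← Pi.add_def, dotProduct_add]
    have : (η ⬝ᵥ fun y => (-1) ^ deg x * (E *ᵥ fun y' => v (x, y')) y) = 0 := by
      have := dotProduct_smul ((-1 : S) ^ deg x) η (E *ᵥ fun y' => v (x, y'))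
      rw [h'.aug_mulVec, smul_zero] at this
      exact this
    rw [this, add_zero]
  have mat_mat : ∀ v, tensorMat deg D E *ᵥ (tensorMat deg D E *ᵥ v) = 0 := by
    intro v
    ext ⟨x, y⟩
    have h1 : (D *ᵥ fun x' => (-1) ^ deg x' * (E *ᵥ fun y' => v (x', y')) y) x =
        - (-1) ^ deg x * (D *ᵥ fun x' => (E *ᵥ fun y' => v (x', y')) y) x := by
      simp only [mulVec, dotProduct, Finset.mul_sum (s := Finset.univ (α := X))]
      refine Finset.sum_congr rfl fun x' _ => ?_
      by_cases hD : D x x' = 0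
      · simp [hD]
      · rw [h.mat_deg _ _ hD, pow_succ]
        ring
    have h2 := congrFun (mulVec_smul E ((-1 : S) ^ deg x) (E *ᵥ fun y' => v (x, y'))) y
    rw [h'.mat_mulVec] at h2
    have h3 := congrFun (h.mat_mulVec fun x' => v (x', y)) x
    have h4 := mulVec_mulVec_comm D E v x y
    rw [tensorMat_mulVec]
    simp only [tensorMat_mulVec]
    rw [← Pi.add_def, ← Pi.add_def, mulVec_add, mulVec_add, Pi.add_apply, Pi.add_apply, h1, h4]
    change (D *ᵥ (D *ᵥ fun x' => v (x', y))) x + _ + _ * (_ +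
      (E *ᵥ ((-1 : S) ^ deg x • (E *ᵥ fun y' => v (x, y')))) y) = 0
    rw [h2, h3]
    simp
  have exact_aug : ∀ (q : ℕ) (v : X × Y → S), tensorMat deg D E *ᵥ v = 0 →
      (∀ x, (η ⬝ᵥ fun y => v (x, y)) = 0) → (∀ x y, q ≤ deg x → v (x, y) = 0) →
      ∃ w, tensorMat deg D E *ᵥ w = v := by
    intro q
    induction q with
    | zero =>
      intro v _ _ hv
      exact ⟨0, by ext ⟨x, y⟩; simp [hv x y]⟩
    | succ q ih =>
      intro v hv hηv hvq
      have hcyc : ∀ x, deg x = q → (E *ᵥ fun y => v (x, y)) = 0 := by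
        intro x hx
        ext y
        have h1 := congrFun hv (x, y)
        have h2 : (D *ᵥ fun x' => v (x', y)) x = 0 := by
          refine Finset.sum_eq_zero fun x' _ => ?_
          by_cases hD : D x x' = 0
          · simp [hD]
          · simp [hvq x' y (by rw [h.mat_deg _ _ hD, hx])]
        rw [tensorMat_mulVec, h2, zero_add] at h1
        have h3 := congrArg (fun z => (-1) ^ deg x * z) h1
        simpa [← mul_assoc, hsgn] using h3
      have hw : ∀ x, ∃ w : Y → S, (deg x = q → (E *ᵥ w) = fun y => v (x, y)) ∧ η ⬝ᵥ w = 0 ∧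
          (deg x ≠ q → w = 0) := by
        intro x
        by_cases hx : deg x = q
        · obtain ⟨w, hw, hw'⟩ := h'.exact_of_aug_eq_zero _ (hcyc x hx) (hηv x)
          exact ⟨w, fun _ => hw, hw', fun hx' => absurd hx hx'⟩
        · exact ⟨0, fun hx' => absurd hx' hx, by simp, fun _ => rfl⟩
      choose w hw hηw hw0 using hw
      let w' : X × Y → S := fun p => (-1) ^ deg p.1 * w p.1 p.2
      have hηw' : ∀ x, (η ⬝ᵥ fun y => w' (x, y)) = 0 := fun x => by
        have := dotProduct_smul ((-1 : S) ^ deg x) η (w x)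
        rw [hηw, smul_zero] at this
        exact this
      have hEw' : ∀ x y, (-1) ^ deg x * (E *ᵥ fun y' => w' (x, y')) y = (E *ᵥ w x) y :=
          fun x y => by
        have := congrFun (mulVec_smul E ((-1 : S) ^ deg x) (w x)) y
        change (E *ᵥ fun y' => w' (x, y')) y = _ at this
        rw [this, Pi.smul_apply, smul_eq_mul, ← mul_assoc, hsgn, one_mul]
      obtain ⟨w'', hw''⟩ := ih (v - tensorMat deg D E *ᵥ w')
        (by rw [mulVec_sub, hv, mat_mat, sub_zero])
        (fun x => by
          have : (fun y => (v - tensorMat deg D E *ᵥ w') (x, y)) =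
            (fun y => v (x, y)) - fun y => (tensorMat deg D E *ᵥ w') (x, y) := rfl
          rw [this, dotProduct_sub, hηv, aug_tensor]
          simp only [hηw']
          simp [← Pi.zero_def])
        (fun x y hx => by
          have h2 : (D *ᵥ fun x' => w' (x', y)) x = 0 := by
            refine Finset.sum_eq_zero fun x' _ => ?_
            by_cases hD : D x x' = 0
            · simp [hD]
            · simp [w', hw0 x' (by rw [h.mat_deg _ _ hD]; omega)]
          rw [Pi.sub_apply, tensorMat_mulVec, h2, hEw', zero_add]
          by_cases hxq : deg x = q
          · rw [hw x hxq, sub_self]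
          · rw [hw0 x hxq, hvq x y (by omega), mulVec_zero, Pi.zero_apply, sub_zero])
      exact ⟨w'' + w', by rw [mulVec_add, hw'', sub_add_cancel]⟩
  refine ⟨?_, ?_, mat_mat, ?_, ?_⟩
  · rintro ⟨x, y⟩ ⟨x', y'⟩ hp
    simp only [tensorMat] at hp
    by_cases hD : D x x' = 0
    · by_cases hE : E y y' = 0
      · simp [hD, hE] at hp
      · have hx : x = x' := by
          by_contra hx
          simp [hD, hx] at hp
        simp only [hx, h'.mat_deg _ _ hE, add_assoc]
    · by_cases hy : y = y'
      · simp only [hy, h.mat_deg _ _ hD]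
        omega
      · have hE : x = x' ∧ E y y' ≠ 0 := by
          by_contra hE
          apply hp
          rw [if_neg hy, zero_add]
          split_ifs with hx
          · rw [not_not.1 fun h0 => hE ⟨hx, h0⟩, mul_zero]
          · rfl
        simp only [hE.1, h'.mat_deg _ _ hE.2, add_assoc]
  · rintro ⟨x, y⟩ hp
    have h1 := h.aug_deg x (left_ne_zero_of_mul hp)
    have h2 := h'.aug_deg y (right_ne_zero_of_mul hp)
    simp [h1, h2]
  · intro v
    rw [dotProduct_tensor]
    simp only [aug_tensor]
    exact h.aug_mulVec _
  · intro v hv hv'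
    rw [dotProduct_tensor] at hv'
    let u : X → S := fun x => η ⬝ᵥ fun y => v (x, y)
    have hDu : D *ᵥ u = 0 := by
      ext x
      rw [← aug_tensor, hv]
      simp [← Pi.zero_def]
    have mem_span : ∀ f : Y → S, η ⬝ᵥ f ∈ Ideal.span (Set.range η) := fun f =>
      sum_mem fun y _ => Ideal.mul_mem_right _ _ (Ideal.subset_span ⟨y, rfl⟩)
    obtain ⟨u', hu', hmem⟩ := hJ u hDu hv' fun x => mem_span _
    have : ∀ x, ∃ w : Y → S, η ⬝ᵥ w = u' x := fun x => by
      obtain ⟨c, hc⟩ := Ideal.mem_span_range_iff_exists_fun.1 (hmem x)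
      exact ⟨c, by rw [← hc]; simp [dotProduct, mul_comm]⟩
    choose w hw using this
    let w' : X × Y → S := fun p => w p.1 p.2
    obtain ⟨w'', hw''⟩ := exact_aug (Finset.univ.sup deg + 1) (v - tensorMat deg D E *ᵥ w')
      (by rw [mulVec_sub, hv, mat_mat, sub_zero])
      (fun x => by
        have : (fun y => (v - tensorMat deg D E *ᵥ w') (x, y)) =
          (fun y => v (x, y)) - fun y => (tensorMat deg D E *ᵥ w') (x, y) := rfl
        rw [this, dotProduct_sub, aug_tensor]
        change u x - (D *ᵥ fun x' => η ⬝ᵥ w x') x = 0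
        simp only [hw]
        change u x - (D *ᵥ u') x = 0
        rw [hu', sub_self])
      (fun x y hx => absurd (Finset.le_sup (f := deg) (Finset.mem_univ x)) (by omega))
    exact ⟨w'' + w', by rw [mulVec_add, hw'', sub_add_cancel]⟩

theorem IsFreeResolution.submatrix {deg : X → ℕ} {D : Matrix X X S} {ε : X → S}
    (h : IsFreeResolution deg D ε) (e : Y ≃ X) :
    IsFreeResolution (deg ∘ e) (D.submatrix e e) (ε ∘ e) := by
  have hmul : ∀ v, D.submatrix e e *ᵥ v = (D *ᵥ (v ∘ e.symm)) ∘ e := fun v =>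
    submatrix_mulVec_equiv D v e e
  have hdot : ∀ v, (ε ∘ e) ⬝ᵥ v = ε ⬝ᵥ (v ∘ e.symm) := fun v => by
    rw [dotProduct_comp_equiv_symm]
  refine ⟨fun x y => h.mat_deg _ _, fun x => h.aug_deg _, fun v => ?_, fun v => ?_,
    fun v hv hv' => ?_⟩
  · rw [hmul, hmul, Function.comp_assoc, e.self_comp_symm, Function.comp_id, h.mat_mulVec]
    rfl
  · rw [hmul, hdot, Function.comp_assoc, e.self_comp_symm, Function.comp_id, h.aug_mulVec]
  · rw [hmul] at hv
    obtain ⟨w, hw⟩ := h.exact (v ∘ e.symm) (by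
      ext x
      have := congrFun hv (e.symm x)
      simpa using this) (by rw [← hdot, hv'])
    refine ⟨w ∘ e, ?_⟩
    rw [hmul, Function.comp_assoc, e.self_comp_symm, Function.comp_id, hw, Function.comp_assoc,
      e.symm_comp_self, Function.comp_id]

end Complexes

end MatroidFacet

namespace MatroidFacet

open MvPolynomial

/-! ### Monomial ideals in disjoint sets of variables -/

section Monomial

variable {σ k : Type*} [Field k]

open Classical in
/-- The sum of the terms of `f` whose exponents satisfy `U`. -/
noncomputable def filterTerms (U : (σ →₀ ℕ) → Prop) : MvPolynomial σ k →ₗ[k] MvPolynomial σ k :=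
  (basisMonomials σ k).constr k fun m => if U m then monomial m 1 else 0

open Classical in
theorem filterTerms_monomial (U : (σ →₀ ℕ) → Prop) (m : σ →₀ ℕ) (a : k) :
    filterTerms U (monomial m a) = if U m then monomial m a else 0 := by
  have h := (basisMonomials σ k).constr_basis k
    (fun m => if U m then monomial m (1 : k) else 0) m
  have h1 : monomial m a = a • basisMonomials σ k m := by
    simp [coe_basisMonomials, smul_monomial]
  rw [h1, map_smul, filterTerms, h]
  split_ifs <;> simp [coe_basisMonomials]

open Classical in
theorem coeff_filterTerms (U : (σ →₀ ℕ) → Prop) (f : MvPolynomial σ k) (m : σ →₀ ℕ) :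
    coeff m (filterTerms U f) = if U m then coeff m f else 0 := by
  induction f using MvPolynomial.induction_on' with
  | monomial u a =>
    rw [filterTerms_monomial]
    by_cases hu : u = m
    · subst hu
      split_ifs <;> simp
    · split_ifs <;> simp [coeff_monomial, hu]
  | add p q hp hq =>
    rw [map_add, coeff_add, hp, hq, coeff_add]
    split_ifs <;> simp

theorem filterTerms_monomial_mul (U : (σ →₀ ℕ) → Prop) (b : σ →₀ ℕ)
    (hb : ∀ m, U (b + m) ↔ U m) (a : k) (f : MvPolynomial σ k) :
    filterTerms U (monomial b a * f) = monomial b a * filterTerms U f := by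
  induction f using MvPolynomial.induction_on' with
  | monomial u c =>
    rw [monomial_mul, filterTerms_monomial, filterTerms_monomial, hb]
    split_ifs
    · rw [monomial_mul]
    · rw [mul_zero]
  | add p q hp hq => rw [mul_add, map_add, hp, hq, map_add, mul_add]

/-- The inclusion `k[x_s : s ∉ V] → k[x_s]`. -/
noncomputable abbrev offAlgebra (k : Type*) [Field k] (V : Set σ) :
    Algebra (MvPolynomial (Vᶜ : Set σ) k) (MvPolynomial σ k) :=
  (rename ((↑) : (Vᶜ : Set σ) → σ) :
    MvPolynomial (Vᶜ : Set σ) k →ₐ[k] MvPolynomial σ k).toRingHom.toAlgebra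

theorem offAlgebra_free (V : Set σ) :
    letI := offAlgebra k V
    Module.Free (MvPolynomial (Vᶜ : Set σ) k) (MvPolynomial σ k) := by
  classical
  let _ := offAlgebra k V
  let e : MvPolynomial σ k ≃ₐ[k] MvPolynomial V (MvPolynomial (Vᶜ : Set σ) k) :=
    (renameEquiv k (Equiv.Set.sumCompl V).symm).trans (sumAlgEquiv k V (Vᶜ : Set σ))
  have he : ∀ r : MvPolynomial (Vᶜ : Set σ) k, e (rename (↑) r) = C r := by
    intro r
    have : e.toAlgHom.comp (rename ((↑) : (Vᶜ : Set σ) → σ)) =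
        IsScalarTower.toAlgHom k (MvPolynomial (Vᶜ : Set σ) k)
          (MvPolynomial V (MvPolynomial (Vᶜ : Set σ) k)) := by
      refine MvPolynomial.algHom_ext fun i => ?_
      have hi : (Equiv.Set.sumCompl V).symm (i : σ) = Sum.inr i :=
        Equiv.Set.sumCompl_symm_apply_compl _
      simp [e, hi, sumAlgEquiv_X_inr, MvPolynomial.algebraMap_eq]
    exact AlgHom.congr_fun this r
  have hsmul : ∀ (r : MvPolynomial (Vᶜ : Set σ) k) (f : MvPolynomial σ k),
      e (r • f) = r • e f := by
    intro r f
    rw [MvPolynomial.smul_eq_C_mul, ← he, ← map_mul]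
    rfl
  exact Module.Free.of_equiv (e.toAddEquiv.toLinearEquiv hsmul).symm

theorem le_add_iff_of_disjoint {t b m : σ →₀ ℕ} (h : Disjoint t.support b.support) :
    t ≤ b + m ↔ t ≤ m := by
  refine ⟨fun h' => ?_, fun h' => h'.trans (by simp)⟩
  intro s
  by_cases hs : s ∈ t.support
  · have hb : b s = 0 := Finsupp.notMem_support_iff.1 (Finset.disjoint_left.1 h hs)
    simpa [hb] using h' s
  · simp [Finsupp.notMem_support_iff.1 hs]

/-- Resolutions of monomial ideals in disjoint sets of variables are Tor-independent: their tensor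
product is a resolution. -/
theorem IsFreeResolution.tensor_of_disjoint_variables {X Y : Type*} [Fintype X] [Fintype Y]
    {deg : X → ℕ} {D : Matrix X X (MvPolynomial σ k)} {ε : X → MvPolynomial σ k}
    (h : IsFreeResolution deg D ε) {deg' : Y → ℕ} {E : Matrix Y Y (MvPolynomial σ k)}
    {η : Y → MvPolynomial σ k} (h' : IsFreeResolution deg' E η) (V : Set σ)
    {T T' : Set (σ →₀ ℕ)} (hT : ∀ m ∈ T, (m.support : Set σ) ⊆ V)
    (hT' : ∀ m ∈ T', Disjoint (m.support : Set σ) V)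
    (hI : Ideal.span (Set.range ε) = Ideal.span ((fun m => monomial m (1 : k)) '' T))
    (hJ : Ideal.span (Set.range η) = Ideal.span ((fun m => monomial m (1 : k)) '' T')) :
    IsFreeResolution (fun p : X × Y => deg p.1 + deg' p.2) (tensorMat deg D E)
      (fun p => ε p.1 * η p.2) := by
  classical
  let _ := offAlgebra k V
  have := offAlgebra_free (k := k) V
  have halg : ∀ r : MvPolynomial (Vᶜ : Set σ) k,
    algebraMap (MvPolynomial (Vᶜ : Set σ) k) (MvPolynomial σ k) r = rename (↑) r := fun _ => rfl
  refine h.tensor h' ?_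
  let U : (σ →₀ ℕ) → Prop := fun m => ∃ t ∈ T, t ≤ m
  have hlin : ∀ (r : MvPolynomial (Vᶜ : Set σ) k) (f : MvPolynomial σ k),
      filterTerms U (rename (↑) r * f) = rename (↑) r * filterTerms U f := by
    intro r f
    induction r using MvPolynomial.induction_on' with
    | monomial u a =>
      rw [rename_monomial]
      refine filterTerms_monomial_mul U _ (fun m => ?_) a f
      refine exists_congr fun t => and_congr_right fun ht => le_add_iff_of_disjoint ?_
      rw [Finset.disjoint_left]
      intro s hs hs'
      obtain ⟨i, -, rfl⟩ := Finset.mem_image.1 (Finsupp.mapDomain_support hs')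
      exact i.2 (hT t ht hs)
    | add p q hp hq => rw [map_add, add_mul, map_add, hp, hq, add_mul]
  let ρ : MvPolynomial σ k →ₗ[MvPolynomial (Vᶜ : Set σ) k] MvPolynomial σ k :=
    { toFun := filterTerms U
      map_add' := map_add _
      map_smul' := hlin }
  have ρ_apply : ∀ f, ρ f = filterTerms U f := fun _ => rfl
  obtain ⟨T₀, hT₀⟩ : ∃ T₀ : Set (MvPolynomial (Vᶜ : Set σ) k),
      (fun m => monomial m (1 : k)) '' T' =
        algebraMap (MvPolynomial (Vᶜ : Set σ) k) (MvPolynomial σ k) '' T₀ := by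
    refine ⟨algebraMap (MvPolynomial (Vᶜ : Set σ) k) (MvPolynomial σ k) ⁻¹'
      ((fun m => monomial m (1 : k)) '' T'), ?_⟩
    rw [Set.image_preimage_eq_iff.2]
    rintro _ ⟨m, hm, rfl⟩
    obtain ⟨q, hq⟩ := exists_rename_eq_of_vars_subset_range (monomial m (1 : k))
      ((↑) : (Vᶜ : Set σ) → σ) Subtype.val_injective (by
        rw [vars_monomial one_ne_zero, Subtype.range_coe]
        exact Set.subset_compl_iff_disjoint_right.2 (hT' m hm))
    exact ⟨q, hq⟩
  rw [hJ, hT₀]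
  refine h.exact_of_ideal ρ (fun f => ?_) (fun f hf => ?_) T₀
  · rw [hI, mem_ideal_span_monomial_image]
    intro m hm
    rw [mem_support_iff, ρ_apply, coeff_filterTerms] at hm
    by_contra hU
    exact hm (if_neg hU)
  · rw [hI, mem_ideal_span_monomial_image] at hf
    ext m
    rw [ρ_apply, coeff_filterTerms]
    split_ifs with hU
    · rfl
    · by_contra hm
      exact hU (hf m (mem_support_iff.2 (Ne.symm hm)))

end Monomial

end MatroidFacet

namespace MatroidFacet

open Matroid

/-! ### Blocks of matroids -/

section Blocks

variable {α : Type*} {M : Matroid α}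

theorem BlockRel.symm {e f : α} (h : BlockRel M e f) : BlockRel M f e := by
  rcases h with rfl | ⟨C, hC, he, hf⟩
  · exact Or.inl rfl
  · exact Or.inr ⟨C, hC, hf, he⟩

theorem exists_isCircuit_of_inter_nonempty [M.Finite] {e g : α} {C₁ C₂ : Set α}
    (h₁ : M.IsCircuit C₁) (h₂ : M.IsCircuit C₂) (he : e ∈ C₁) (hg : g ∈ C₂)
    (h : (C₁ ∩ C₂).Nonempty) : ∃ C, M.IsCircuit C ∧ e ∈ C ∧ g ∈ C := by
  induction hn : (C₁ ∪ C₂).ncard using Nat.strong_induction_on generalizing C₁ C₂ with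
  | _ n ih =>
  subst hn
  have hfin : (C₁ ∪ C₂).Finite :=
    M.ground_finite.subset (Set.union_subset h₁.subset_ground h₂.subset_ground)
  by_cases hg₁ : g ∈ C₁
  · exact ⟨C₁, h₁, he, hg₁⟩
  by_cases he₂ : e ∈ C₂
  · exact ⟨C₂, h₂, he₂, hg⟩
  obtain ⟨f, hf₁, hf₂⟩ := h
  obtain ⟨C₃, hs₃, h₃, he₃⟩ := h₁.strong_elimination h₂ hf₁ hf₂ he he₂
  obtain ⟨C₄, hs₄, h₄, hg₄⟩ := h₂.strong_elimination h₁ hf₂ hf₁ hg hg₁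
  rw [Set.union_comm] at hs₄
  have h₃₁ : ¬ C₃ ⊆ C₁ := fun hs => by
    rw [← h₃.eq_of_subset_isCircuit h₁ hs] at hf₁
    exact (hs₃ hf₁).2 rfl
  have h₄₂ : ¬ C₄ ⊆ C₂ := fun hs => by
    rw [← h₄.eq_of_subset_isCircuit h₂ hs] at hf₂
    exact (hs₄ hf₂).2 rfl
  obtain ⟨x, hx₃, hx₁⟩ := Set.not_subset.1 h₃₁
  obtain ⟨y, hy₄, hy₂⟩ := Set.not_subset.1 h₄₂
  have hx₂ : x ∈ C₂ := (hs₃ hx₃).1.resolve_left hx₁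
  have hy₁ : y ∈ C₁ := (hs₄ hy₄).1.resolve_right hy₂
  have hsub₄ : C₁ ∪ C₄ ⊆ C₁ ∪ C₂ :=
    Set.union_subset Set.subset_union_left (hs₄.trans Set.sdiff_subset)
  by_cases hx₄ : x ∈ C₄
  · refine ih _ (Set.ncard_lt_ncard ?_ hfin) h₃ h₄ he₃ hg₄ ⟨x, hx₃, hx₄⟩ rfl
    refine Set.ssubset_iff_subset_ne.2
      ⟨Set.union_subset (hs₃.trans Set.sdiff_subset) (hs₄.trans Set.sdiff_subset), fun heq => ?_⟩
    have hf : f ∈ C₃ ∪ C₄ := heq ▸ Or.inl hf₁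
    rcases hf with hf | hf
    · exact (hs₃ hf).2 rfl
    · exact (hs₄ hf).2 rfl
  · refine ih _ (Set.ncard_lt_ncard ?_ hfin) h₁ h₄ he hg₄ ⟨y, hy₁, hy₄⟩ rfl
    refine Set.ssubset_iff_subset_ne.2 ⟨hsub₄, fun heq => ?_⟩
    have hx : x ∈ C₁ ∪ C₄ := heq ▸ Or.inr hx₂
    exact hx.elim hx₁ hx₄

theorem BlockRel.trans [M.Finite] {e f g : α} (h : BlockRel M e f) (h' : BlockRel M f g) :
    BlockRel M e g := by
  rcases h with rfl | ⟨C, hC, he, hf⟩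
  · exact h'
  · rcases h' with rfl | ⟨C', hC', hf', hg⟩
    · exact Or.inr ⟨C, hC, he, hf⟩
    · exact Or.inr (exists_isCircuit_of_inter_nonempty hC hC' he hg ⟨f, hf, hf'⟩)

theorem IsBlock.eq_of_mem [M.Finite] {A B : Set α} (hA : IsBlock M A) (hB : IsBlock M B) {e : α}
    (heA : e ∈ A) (heB : e ∈ B) : A = B := by
  obtain ⟨a, -, rfl⟩ := hA
  obtain ⟨b, -, rfl⟩ := hB
  ext f
  exact and_congr_right fun _ =>
    ⟨fun h => (heB.2.trans heA.2.symm).trans h, fun h => (heA.2.trans heB.2.symm).trans h⟩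

theorem exists_isBlock_mem {e : α} (he : e ∈ M.E) : ∃ B, IsBlock M B ∧ e ∈ B :=
  ⟨_, ⟨e, he, rfl⟩, he, Or.inl rfl⟩

theorem exists_isBlock_isCircuit_subset {C : Set α} (hC : M.IsCircuit C) :
    ∃ B, IsBlock M B ∧ C ⊆ B := by
  obtain ⟨e, he⟩ := hC.nonempty
  exact ⟨_, ⟨e, hC.subset_ground he, rfl⟩,
    fun f hf => ⟨hC.subset_ground hf, Or.inr ⟨C, hC, he, hf⟩⟩⟩

theorem indep_of_forall_isBlock {I : Set α} (hI : I ⊆ M.E)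
    (h : ∀ B, IsBlock M B → M.Indep (I ∩ B)) : M.Indep I := by
  by_contra hdep
  obtain ⟨C, hCI, hC⟩ := ((not_indep_iff hI).1 hdep).exists_isCircuit_subset
  obtain ⟨B, hB, hCB⟩ := exists_isBlock_isCircuit_subset hC
  exact hC.not_indep ((h B hB).subset (Set.subset_inter hCI hCB))

/-- The bases of a matroid are the unions of bases of its blocks. -/
theorem isBase_iff_forall_isBlock [M.Finite] {I : Set α} (hI : I ⊆ M.E) :
    M.IsBase I ↔ ∀ B, IsBlock M B → (M.restrict B).IsBase (I ∩ B) := by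
  have insert_inter : ∀ {A B : Set α} {e : α}, IsBlock M A → IsBlock M B → e ∈ B → A ≠ B →
      insert e I ∩ A = I ∩ A := fun {A B e} hA hB he hne => by
    rw [Set.insert_inter_of_notMem fun heA => hne (hA.eq_of_mem hB heA he)]
  constructor
  · intro h B hB
    rw [isBase_restrict_iff hB.subset_ground]
    refine (h.indep.subset Set.inter_subset_left).isBasis_of_forall_insert Set.inter_subset_right
      fun e he => ?_
    have heE := hB.subset_ground he.1
    have heI : e ∉ I := fun heI => he.2 ⟨heI, he.1⟩
    rw [← not_indep_iff (Set.insert_subset heE (Set.inter_subset_left.trans hI))]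
    intro hind
    refine (h.insert_dep ⟨heE, heI⟩).not_indep
      (indep_of_forall_isBlock (Set.insert_subset heE hI) fun A hA => ?_)
    by_cases hAB : A = B
    · rwa [hAB, Set.insert_inter_of_mem he.1]
    · rw [insert_inter hA hB he.1 hAB]
      exact h.indep.subset Set.inter_subset_left
  · intro h
    have h' : ∀ B, IsBlock M B → M.IsBasis (I ∩ B) B := fun B hB =>
      (isBase_restrict_iff hB.subset_ground).1 (h B hB)
    refine (indep_of_forall_isBlock hI fun B hB => (h' B hB).indep).isBase_of_forall_insert
      fun e he hind => ?_
    obtain ⟨B, hB, heB⟩ := exists_isBlock_mem he.1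
    refine ((h' B hB).insert_dep ⟨heB, fun heI => he.2 heI.1⟩).not_indep (hind.subset ?_)
    exact Set.insert_subset_insert Set.inter_subset_left

end Blocks

/-! ### The facet ideal is the product of the ideals of the blocks -/

section FacetIdeal

open MvPolynomial

/-- The exponents `∑_{e ∈ σ} 1_e`, where `σ` is a basis of `N`. -/
def facetExponents {α : Type*} (E : Set α) (N : Matroid α) : Set (E →₀ ℕ) :=
  {m | ∃ σ : Finset E, N.IsBase (Subtype.val '' (σ : Set E)) ∧
    m = ∑ e ∈ σ, Finsupp.single e 1}

variable (k : Type*) [Field k] {α : Type*} (M : Matroid α)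

theorem monomial_sum_single {τ : Type*} (s : Finset τ) :
    monomial (∑ e ∈ s, Finsupp.single e 1) (1 : k) = ∏ e ∈ s, X e :=
  monomial_sum_one s _

theorem facetIdeal_eq_span :
    facetIdeal k M = Ideal.span ((fun m => monomial m (1 : k)) '' facetExponents M.E M) := by
  rw [facetIdeal]
  congr 1
  ext f
  constructor
  · rintro ⟨σ, hσ, rfl⟩
    exact ⟨_, ⟨σ, hσ, rfl⟩, monomial_sum_single k σ⟩
  · rintro ⟨_, ⟨σ, hσ, rfl⟩, rfl⟩
    exact ⟨σ, hσ, monomial_sum_single k σ⟩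

theorem blockIdeal_eq_span {B : Set α} (h : B ⊆ M.E) :
    blockIdeal k M h =
      Ideal.span ((fun m => monomial m (1 : k)) '' facetExponents M.E (M.restrict B)) := by
  classical
  refine (Ideal.map_span (rename (Set.inclusion h) : MvPolynomial B k →ₐ[k] MvPolynomial M.E k)
    {f | ∃ σ : Finset B, (M.restrict B).IsBase (Subtype.val '' (σ : Set B)) ∧
      f = ∏ e ∈ σ, X e}).trans ?_
  congr 1
  ext f
  constructor
  · rintro ⟨_, ⟨σ, hσ, rfl⟩, rfl⟩
    refine ⟨_, ⟨σ.map ⟨Set.inclusion h, Set.inclusion_injective h⟩, ?_, rfl⟩, ?_⟩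
    · rw [Finset.coe_map, Set.image_image]
      exact hσ
    · change monomial _ _ = _
      rw [monomial_sum_single, Finset.prod_map]
      simp
  · rintro ⟨_, ⟨σ, hσ, rfl⟩, rfl⟩
    have hσB : ∀ e ∈ σ, (e : α) ∈ B := fun e he => hσ.subset_ground ⟨e, he, rfl⟩
    let σ' : Finset B := σ.attach.image fun e => ⟨e.1, hσB e.1 e.2⟩
    have hσ' : σ'.map ⟨Set.inclusion h, Set.inclusion_injective h⟩ = σ := by
      ext e
      simp [σ', Set.inclusion, Subtype.ext_iff]
      exact hσB e
    refine ⟨∏ e ∈ σ', X e, ⟨σ', ?_, rfl⟩, ?_⟩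
    · rw [← hσ', Finset.coe_map, Set.image_image] at hσ
      exact hσ
    · change _ = monomial _ _
      rw [monomial_sum_single, ← hσ', Finset.prod_map]
      simp

variable {M}

theorem support_subset_of_mem_facetExponents {B : Set α} {m : M.E →₀ ℕ}
    (hm : m ∈ facetExponents M.E (M.restrict B)) :
    (m.support : Set M.E) ⊆ Subtype.val ⁻¹' B := by
  classical
  obtain ⟨σ, hσ, rfl⟩ := hm
  intro e he
  have := Finsupp.support_finsetSum he
  simp only [Finset.mem_biUnion, Finsupp.mem_support_single] at this
  obtain ⟨f, hf, rfl, -⟩ := this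
  exact hσ.subset_ground ⟨e, hf, rfl⟩

theorem facetExponents_eq_sum [M.Finite] {t : ℕ} {B : Fin t → Set α} (hB : ∀ j, IsBlock M (B j))
    (hinj : Function.Injective B) (hall : ∀ X, IsBlock M X → ∃ j, B j = X) :
    facetExponents M.E M =
      {m | ∃ g : Fin t → (M.E →₀ ℕ), (∀ j, g j ∈ facetExponents M.E (M.restrict (B j))) ∧
        m = ∑ j, g j} := by
  classical
  have hdisj : ∀ {i j e}, e ∈ B i → e ∈ B j → i = j := fun hi hj =>
    hinj ((hB _).eq_of_mem (hB _) hi hj)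
  ext m
  constructor
  · rintro ⟨σ, hσ, rfl⟩
    rw [isBase_iff_forall_isBlock hσ.subset_ground] at hσ
    refine ⟨fun j => ∑ e ∈ σ.filter (fun e : M.E => (e : α) ∈ B j), Finsupp.single e 1,
      fun j => ⟨_, ?_, rfl⟩, ?_⟩
    · convert hσ (B j) (hB j) using 1
      ext e
      simp only [Set.mem_image, Finset.mem_coe, Finset.mem_filter, Set.mem_inter_iff]
      constructor
      · rintro ⟨x, ⟨hx, hxB⟩, rfl⟩
        exact ⟨⟨x, hx, rfl⟩, hxB⟩
      · rintro ⟨⟨x, hx, rfl⟩, hxB⟩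
        exact ⟨x, ⟨hx, hxB⟩, rfl⟩
    · simp only [Finset.sum_filter]
      rw [Finset.sum_comm]
      refine Finset.sum_congr rfl fun e _ => ?_
      obtain ⟨A, hA, heA⟩ := exists_isBlock_mem e.2
      obtain ⟨j, rfl⟩ := hall A hA
      rw [Finset.sum_eq_single j (fun i _ hij => if_neg fun hi => hij (hdisj hi heA))
        (by simp), if_pos heA]
  · rintro ⟨g, hg, rfl⟩
    choose σ hσ hgσ using hg
    have hσB : ∀ j, ∀ e ∈ σ j, (e : α) ∈ B j := fun j e he =>
      (hσ j).subset_ground ⟨e, he, rfl⟩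
    refine ⟨Finset.univ.biUnion σ, ?_, ?_⟩
    · rw [isBase_iff_forall_isBlock (by rintro _ ⟨x, -, rfl⟩; exact x.2)]
      intro A hA
      obtain ⟨j, rfl⟩ := hall A hA
      convert hσ j using 1
      ext e
      simp only [Set.mem_image, Finset.mem_coe, Finset.mem_biUnion, Set.mem_inter_iff,
        Finset.mem_univ, true_and]
      constructor
      · rintro ⟨⟨x, ⟨i, hx⟩, rfl⟩, hxB⟩
        rw [hdisj (hσB i x hx) hxB] at hx
        exact ⟨x, hx, rfl⟩
      · rintro ⟨x, hx, rfl⟩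
        exact ⟨⟨x, ⟨j, hx⟩, rfl⟩, hσB j x hx⟩
    · rw [Finset.sum_biUnion fun i _ j _ hij => Finset.disjoint_left.2 fun e hi hj =>
        hij (hdisj (hσB i e hi) (hσB j e hj))]
      exact Finset.sum_congr rfl fun j _ => hgσ j

end FacetIdeal

end MatroidFacet

namespace MatroidFacet

open MvPolynomial Matrix

/-! ### The tensor product of a finite family of complexes -/

section Family

variable {S : Type*} [CommRing S]

open Classical in
/-- The boundary of the tensor product of a finite family of complexes. -/
noncomputable def totalMat {t : ℕ} {X : Fin t → Type} (deg : ∀ j, X j → ℕ)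
    (D : ∀ j, Matrix (X j) (X j) S) : Matrix (∀ j, X j) (∀ j, X j) S :=
  fun x y => ∑ j,
    if ∀ a, a ≠ j → x a = y a then
      (-1) ^ (∑ a ∈ Finset.univ.filter (fun a => a < j), deg a (y a)) * D j (x j) (y j)
    else 0

theorem totalMat_cons {t : ℕ} {X : Fin (t + 1) → Type} (deg : ∀ j, X j → ℕ)
    (D : ∀ j, Matrix (X j) (X j) S) :
    (totalMat deg D).submatrix (Fin.consEquiv X) (Fin.consEquiv X) =
      tensorMat (deg 0) (D 0) (totalMat (fun j => deg j.succ) (fun j => D j.succ)) := by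
  classical
  ext ⟨x, x'⟩ ⟨y, y'⟩
  simp only [submatrix_apply, totalMat, tensorMat, Fin.consEquiv, Equiv.coe_fn_mk,
    Fin.sum_univ_succ, Fin.cons_zero, Fin.cons_succ]
  congr 1
  · have h : (∀ a, a ≠ 0 → (Fin.cons x x' : ∀ j, X j) a = (Fin.cons y y' : ∀ j, X j) a) ↔
        x' = y' := by
      rw [Fin.forall_fin_succ]
      simp [funext_iff]
    simp only [h]
    simp
  · have h : ∀ j : Fin t, (∀ a, a ≠ j.succ →
        (Fin.cons x x' : ∀ j, X j) a = (Fin.cons y y' : ∀ j, X j) a) ↔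
          x = y ∧ ∀ a, a ≠ j → x' a = y' a := by
      intro j
      rw [Fin.forall_fin_succ]
      simp [(Fin.succ_ne_zero _).symm]
    simp only [h]
    by_cases hxy : x = y
    · simp only [hxy, true_and, if_true, Finset.mul_sum]
      refine Finset.sum_congr rfl fun j _ => ?_
      rw [mul_ite, mul_zero, ← mul_assoc, ← pow_add, Finset.sum_filter, Finset.sum_filter,
        Fin.sum_univ_succ]
      simp
    · simp [hxy]

theorem span_range_prod {ι : Type*} [Fintype ι] {X : ι → Type*} (ε : ∀ j, X j → S) :
    Ideal.span (Set.range fun x : ∀ j, X j => ∏ j, ε j (x j)) =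
      ∏ j, Ideal.span (Set.range (ε j)) := by
  rw [Ideal.prod_span]
  congr 1
  ext f
  rw [Set.mem_fintype_prod]
  constructor
  · rintro ⟨x, rfl⟩
    exact ⟨_, fun j => ⟨x j, rfl⟩, rfl⟩
  · rintro ⟨g, hg, rfl⟩
    choose x hx using hg
    exact ⟨x, Finset.prod_congr rfl fun j _ => hx j⟩

theorem prod_span_monomial {ι σ k : Type*} [Fintype ι] [Field k] (T : ι → Set (σ →₀ ℕ)) :
    ∏ j, Ideal.span ((fun m => monomial m (1 : k)) '' T j) =
      Ideal.span ((fun m => monomial m (1 : k)) ''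
        {m | ∃ g : ι → (σ →₀ ℕ), (∀ j, g j ∈ T j) ∧ m = ∑ j, g j}) := by
  rw [Ideal.prod_span]
  congr 1
  ext f
  rw [Set.mem_fintype_prod]
  constructor
  · rintro ⟨g, hg, rfl⟩
    choose m hm hgm using hg
    refine ⟨_, ⟨m, hm, rfl⟩, ?_⟩
    simp only [monomial_sum_one]
    exact Finset.prod_congr rfl fun j _ => hgm j
  · rintro ⟨_, ⟨g, hg, rfl⟩, rfl⟩
    exact ⟨_, fun j => ⟨g j, hg j, rfl⟩, (monomial_sum_one _ _).symm⟩

/-- The tensor product of resolutions of monomial ideals in pairwise disjoint sets of variables is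
a resolution. -/
theorem isFreeResolution_totalMat {σ k : Type*} [Field k] {t : ℕ} {X : Fin t → Type}
    [∀ j, Fintype (X j)] {deg : ∀ j, X j → ℕ} {D : ∀ j, Matrix (X j) (X j) (MvPolynomial σ k)}
    {ε : ∀ j, X j → MvPolynomial σ k} (h : ∀ j, IsFreeResolution (deg j) (D j) (ε j))
    (V : Fin t → Set σ) (hV : Pairwise fun i j => Disjoint (V i) (V j))
    (T : Fin t → Set (σ →₀ ℕ)) (hT : ∀ j, ∀ m ∈ T j, (m.support : Set σ) ⊆ V j)
    (hI : ∀ j, Ideal.span (Set.range (ε j)) = Ideal.span ((fun m => monomial m (1 : k)) '' T j)) :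
    IsFreeResolution (fun x : ∀ j, X j => ∑ j, deg j (x j)) (totalMat deg D)
      (fun x => ∏ j, ε j (x j)) := by
  classical
  induction t with
  | zero =>
    have h0 : totalMat deg D = 0 := by
      ext x y
      simp [totalMat]
    refine ⟨?_, ?_, ?_, ?_, fun v _ hv => ⟨0, ?_⟩⟩
    · simp [h0]
    · simp
    · simp [h0]
    · simp [h0]
    · ext x
      simp only [dotProduct, Finset.univ_eq_empty, Finset.prod_empty, one_mul,
        Fintype.sum_unique] at hv
      rw [Subsingleton.elim x default, hv, mulVec_zero, Pi.zero_apply]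
  | succ t ih =>
    have h1 := ih (fun j => h j.succ) (fun j => V j.succ)
      (fun i j hij => hV ((Fin.succ_injective t).ne hij)) (fun j => T j.succ)
      (fun j => hT j.succ) (fun j => hI j.succ)
    have h2 := (h 0).tensor_of_disjoint_variables h1 (V 0) (hT 0)
      (T' := {m | ∃ g : Fin t → (σ →₀ ℕ), (∀ j, g j ∈ T j.succ) ∧ m = ∑ j, g j}) (by
        rintro _ ⟨g, hg, rfl⟩
        rw [Set.disjoint_left]
        intro s hs
        have := Finsupp.support_finsetSum hs
        rw [Finset.mem_biUnion] at this
        obtain ⟨j, -, hj⟩ := this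
        exact Set.disjoint_left.1 (hV (Fin.succ_ne_zero j)) (hT j.succ _ (hg j) hj)) (hI 0) (by
        rw [span_range_prod, ← prod_span_monomial]
        exact Finset.prod_congr rfl fun j _ => hI j.succ)
    rw [← totalMat_cons] at h2
    have h3 := h2.submatrix (Fin.consEquiv X).symm
    convert h3 using 1
    · ext x
      simp [Fin.sum_univ_succ, Fin.consEquiv, Fin.tail]
    · simp
    · ext1 x
      simp [Fin.prod_univ_succ, Fin.consEquiv, Fin.tail]

end Family

end MatroidFacet

namespace MatroidFacet

open MvPolynomial Matrix

/-! ### Graded sequences and their total complexes -/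

section GradedSequences

variable {σ k : Type*} [Field k]

theorem degree_of_mem_support_mul {f g : MvPolynomial σ k} {a b c d : ℕ}
    (hf : ∀ s ∈ f.support, s.degree + a = b) (hg : ∀ s ∈ g.support, s.degree + c = d) :
    ∀ s ∈ (f * g).support, s.degree + (a + c) = b + d := by
  classical
  intro s hs
  obtain ⟨s₁, h₁, s₂, h₂, rfl⟩ := Finset.mem_add.1 (support_mul f g hs)
  rw [map_add, ← hf s₁ h₁, ← hg s₂ h₂]
  omega

theorem mem_support_sum_exists {ι : Type*} {A : Finset ι} {f : ι → MvPolynomial σ k} {s : σ →₀ ℕ}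
    (hs : s ∈ (∑ i ∈ A, f i).support) : ∃ i ∈ A, s ∈ (f i).support := by
  classical
  simpa using support_sum hs

theorem isHomogeneousVec_mulVec {ι κ : Type} [Fintype κ] {deg : ι → ℕ} {deg' : κ → ℕ}
    {A : Matrix ι κ (MvPolynomial σ k)}
    (hA : ∀ b c, ∀ s ∈ (A b c).support, s.degree + deg b = deg' c) {m : ℕ}
    {v : κ → MvPolynomial σ k} (hv : IsHomogeneousVec deg' m v) :
    IsHomogeneousVec deg m (A *ᵥ v) := by
  intro b s hs
  obtain ⟨c, -, hc⟩ := mem_support_sum_exists hs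
  have := degree_of_mem_support_mul (hA b c) (hv c) s hc
  omega

theorem isHomogeneousVec_single {ι : Type} [DecidableEq ι] (deg : ι → ℕ) (b : ι) :
    IsHomogeneousVec deg (deg b) (Pi.single b 1 : ι → MvPolynomial σ k) := by
  classical
  intro c s hs
  by_cases h : c = b
  · subst h
    rw [Pi.single_eq_same, mem_support_iff, coeff_one] at hs
    have : s = 0 := by
      by_contra h0
      exact hs (if_neg (Ne.symm h0))
    simp [this]
  · simp [Pi.single_eq_of_ne h] at hs

theorem mem_smul_top_pi_iff {R ι : Type*} [CommRing R] [Finite ι] {J : Ideal R} {v : ι → R} :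
    v ∈ J • (⊤ : Submodule R (ι → R)) ↔ ∀ b, v b ∈ J := by
  classical
  have := Fintype.ofFinite ι
  constructor
  · intro hv
    refine Submodule.smul_induction_on hv ?_ ?_
    · intro r hr w _ b
      exact J.mul_mem_right _ hr
    · intro x y hx hy b
      exact J.add_mem (hx b) (hy b)
  · intro hv
    rw [pi_eq_sum_univ' v]
    exact sum_mem fun b _ => Submodule.smul_mem_smul (hv b) trivial

namespace GradedFreeSeq

variable {G : GradedFreeSeq σ k} {I : Ideal (MvPolynomial σ k)}

theorem d_apply (u : ℕ) (v : G.gens (u + 1) → MvPolynomial σ k) : G.d u v = G.mat u *ᵥ v := rfl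

theorem IsMinimalGradedResolution.degree_mat (h : G.IsMinimalGradedResolution I) (u : ℕ)
    (b : G.gens u) (c : G.gens (u + 1)) :
    ∀ s ∈ (G.mat u b c).support, s.degree + G.deg u b = G.deg (u + 1) c := by
  classical
  have := h.degree_preserving u _ _ (isHomogeneousVec_single (G.deg (u + 1)) c) b
  rwa [d_apply, mulVec_single_one] at this

theorem IsMinimalGradedResolution.mat_mem (h : G.IsMinimalGradedResolution I) (u : ℕ)
    (b : G.gens u) (c : G.gens (u + 1)) :
    G.mat u b c ∈ Ideal.span (Set.range (X : σ → MvPolynomial σ k)) := by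
  classical
  have := mem_smul_top_pi_iff.1 (h.minimal u ⟨Pi.single c 1, rfl⟩) b
  rwa [d_apply, mulVec_single_one] at this

theorem entry_succ (u : ℕ) (b : G.gens u) (c : G.gens (u + 1)) :
    G.entry ⟨u, b⟩ ⟨u + 1, c⟩ = G.mat u b c := by
  simp [entry]

theorem entry_ne_zero {x y : Σ u, G.gens u} (h : G.entry x y ≠ 0) : y.1 = x.1 + 1 := by
  by_contra hne
  exact h (dif_neg hne)

theorem IsMinimalGradedResolution.degree_entry (h : G.IsMinimalGradedResolution I)
    (x y : Σ u, G.gens u) :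
    ∀ s ∈ (G.entry x y).support, s.degree + G.deg x.1 x.2 = G.deg y.1 y.2 := by
  obtain ⟨u, b⟩ := x
  obtain ⟨w, c⟩ := y
  by_cases hw : w = u + 1
  · subst hw
    rw [entry_succ]
    exact h.degree_mat u b c
  · have : G.entry ⟨u, b⟩ ⟨w, c⟩ = 0 := dif_neg hw
    simp [this]

theorem IsMinimalGradedResolution.entry_mem (h : G.IsMinimalGradedResolution I)
    (x y : Σ u, G.gens u) :
    G.entry x y ∈ Ideal.span (Set.range (X : σ → MvPolynomial σ k)) := by
  obtain ⟨u, b⟩ := x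
  obtain ⟨w, c⟩ := y
  by_cases hw : w = u + 1
  · subst hw
    rw [entry_succ]
    exact h.mat_mem u b c
  · have : G.entry ⟨u, b⟩ ⟨w, c⟩ = 0 := dif_neg hw
    simp [this]

theorem HasLinearShape.finite_sigma {r l : ℕ} {n : ℕ → ℕ} (h : G.HasLinearShape r l n) :
    Finite (Σ u, G.gens u) := by
  refine Finite.of_surjective
    (fun x : Σ u : Fin (l + 1), G.gens u => (⟨x.1, x.2⟩ : Σ u, G.gens u)) ?_
  rintro ⟨u, b⟩
  have hu : u < l + 1 := by
    by_contra hu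
    have h0 := h.rank_eq u
    rw [h.rank_zero u (by omega), Fintype.card_eq_zero_iff] at h0
    exact h0.elim b
  exact ⟨⟨⟨u, hu⟩, b⟩, rfl⟩

/-- The set `X` with the total boundary `D` describes the sum of all terms of `G`. -/
structure IsTotalization (G : GradedFreeSeq σ k) {X : Type*} (deg : X → ℕ)
    (D : Matrix X X (MvPolynomial σ k)) (φ : ∀ u, G.gens u → X) : Prop where
  injective : ∀ u, Function.Injective (φ u)
  deg_eq : ∀ u b, deg (φ u b) = u
  surjective : ∀ u x, deg x = u → ∃ b, φ u b = x
  mat_eq : ∀ u b c, D (φ u b) (φ (u + 1) c) = G.mat u b c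
  mat_deg : ∀ x y, D x y ≠ 0 → deg y = deg x + 1

namespace IsTotalization

variable {X : Type*} {deg : X → ℕ} {D : Matrix X X (MvPolynomial σ k)}
  {φ : ∀ u, G.gens u → X}

theorem ext (hφ : G.IsTotalization deg D φ) {v w : X → MvPolynomial σ k}
    (h : ∀ u, v ∘ φ u = w ∘ φ u) : v = w := by
  ext1 x
  obtain ⟨b, hb⟩ := hφ.surjective _ x rfl
  have := congrFun (h _) b
  rwa [Function.comp_apply, Function.comp_apply, hb] at this

theorem exists_eq (hφ : G.IsTotalization deg D φ) (w : ∀ u, G.gens u → MvPolynomial σ k) :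
    ∃ v : X → MvPolynomial σ k, ∀ u, v ∘ φ u = w u := by
  refine ⟨fun x => Function.extend (φ (deg x)) (w (deg x)) 0 x, fun u => ?_⟩
  ext1 b
  rw [Function.comp_apply, hφ.deg_eq, (hφ.injective u).extend_apply]

variable [Fintype X]

theorem mulVec_apply (hφ : G.IsTotalization deg D φ) (v : X → MvPolynomial σ k) (u : ℕ) :
    (D *ᵥ v) ∘ φ u = G.d u (v ∘ φ (u + 1)) := by
  ext1 b
  rw [d_apply, Function.comp_apply, mulVec, mulVec, dotProduct, dotProduct]
  symm
  refine Fintype.sum_of_injective (φ (u + 1)) (hφ.injective _) _ _ (fun x hx => ?_) fun c => ?_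
  · by_cases hD : D (φ u b) x = 0
    · simp [hD]
    · obtain ⟨c, hc⟩ := hφ.surjective (u + 1) x (by rw [hφ.mat_deg _ _ hD, hφ.deg_eq])
      exact absurd ⟨c, hc⟩ hx
  · rw [hφ.mat_eq, Function.comp_apply]

theorem dotProduct_eq (hφ : G.IsTotalization deg D φ) {e : X → MvPolynomial σ k}
    (he : ∀ x, e x ≠ 0 → deg x = 0) (v : X → MvPolynomial σ k) :
    e ⬝ᵥ v = ∑ b, e (φ 0 b) * v (φ 0 b) := by
  symm
  refine Fintype.sum_of_injective (φ 0) (hφ.injective _) _ _ (fun x hx => ?_) fun c => rfl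
  by_cases h : e x = 0
  · simp [h]
  · exact absurd (hφ.surjective 0 x (he x h)) hx

theorem exists_isFreeResolution (hφ : G.IsTotalization deg D φ)
    (h : G.IsMinimalGradedResolution I) :
    ∃ e : X → MvPolynomial σ k, IsFreeResolution deg D e ∧ Ideal.span (Set.range e) = I ∧
      ∀ u b, (e (φ u b)).IsHomogeneous (G.deg u b) := by
  classical
  obtain ⟨ε, hεdeg, hεrange, hεker⟩ := h.augmentation
  obtain ⟨e, he⟩ := hφ.exists_eq fun u b =>
    if hu : u = 0 then ε (Pi.single (hu ▸ b) 1) else 0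
  have he0 : ∀ b, e (φ 0 b) = ε (Pi.single b 1) := fun b => congrFun (he 0) b
  have he1 : ∀ u, u ≠ 0 → ∀ b, e (φ u b) = 0 := fun u hu b => by
    have := congrFun (he u) b
    rwa [dif_neg hu] at this
  have hedeg : ∀ x, e x ≠ 0 → deg x = 0 := fun x hx => by
    by_contra h0
    obtain ⟨b, hb⟩ := hφ.surjective _ x rfl
    exact hx (by rw [← hb, he1 _ h0])
  have hdot : ∀ v : X → MvPolynomial σ k, e ⬝ᵥ v = ε (v ∘ φ 0) := fun v => by
    rw [hφ.dotProduct_eq hedeg]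
    conv_rhs => rw [pi_eq_sum_univ' (v ∘ φ 0)]
    rw [map_sum]
    refine Finset.sum_congr rfl fun b _ => ?_
    rw [map_smul, he0, smul_eq_mul, mul_comm]
    rfl
  have hdd : ∀ u v, G.d u (G.d (u + 1) v) = 0 := fun u v => by
    have : G.d (u + 1) v ∈ LinearMap.ker (G.d u) := h.exact u ▸ ⟨v, rfl⟩
    exact this
  refine ⟨e, ⟨hφ.mat_deg, hedeg, fun v => ?_, fun v => ?_, fun v hv hv' => ?_⟩, ?_, ?_⟩
  · refine hφ.ext fun u => ?_
    rw [hφ.mulVec_apply, hφ.mulVec_apply, hdd]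
    rfl
  · rw [hdot, hφ.mulVec_apply]
    have : G.d 0 (v ∘ φ 1) ∈ LinearMap.ker ε := hεker ▸ ⟨_, rfl⟩
    exact this
  · have hw : ∀ u, ∃ w, G.d u w = v ∘ φ u := by
      intro u
      cases u with
      | zero =>
        have : v ∘ φ 0 ∈ LinearMap.range (G.d 0) := by
          rw [← hεker, LinearMap.mem_ker, ← hdot, hv']
        exact this
      | succ u =>
        have : v ∘ φ (u + 1) ∈ LinearMap.range (G.d (u + 1)) := by
          rw [h.exact, LinearMap.mem_ker, ← hφ.mulVec_apply, hv]
          rfl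
        exact this
    choose w hw using hw
    obtain ⟨W, hW⟩ := hφ.exists_eq fun u => Nat.casesOn u 0 w
    refine ⟨W, hφ.ext fun u => ?_⟩
    rw [hφ.mulVec_apply, hW (u + 1), ← hw u]
  · ext f
    rw [Ideal.mem_span_range_iff_exists_fun, ← hεrange, LinearMap.mem_range]
    constructor
    · rintro ⟨c, hc⟩
      refine ⟨c ∘ φ 0, ?_⟩
      rw [← hdot, ← hc, dotProduct]
      exact Finset.sum_congr rfl fun x _ => mul_comm _ _
    · rintro ⟨w, rfl⟩
      obtain ⟨W, hW⟩ := hφ.exists_eq fun u => Nat.casesOn u w fun _ => 0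
      refine ⟨W, ?_⟩
      have : ε (W ∘ φ 0) = ε w := congrArg ε (hW 0)
      rw [← this, ← hdot, dotProduct]
      exact Finset.sum_congr rfl fun x _ => mul_comm _ _
  · intro u b
    by_cases hu : u = 0
    · subst hu
      rw [he0]
      exact hεdeg _ _ (isHomogeneousVec_single _ b)
    · rw [he1 u hu]
      exact isHomogeneous_zero _ _ _

theorem isMinimalGradedResolution (hφ : G.IsTotalization deg D φ) {e : X → MvPolynomial σ k}
    (h : IsFreeResolution deg D e) (hI : Ideal.span (Set.range e) = I)
    (he : ∀ b, (e (φ 0 b)).IsHomogeneous (G.deg 0 b))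
    (hdeg : ∀ u b c, ∀ s ∈ (G.mat u b c).support, s.degree + G.deg u b = G.deg (u + 1) c)
    (hmin : ∀ u b c, G.mat u b c ∈
      Ideal.span (Set.range (MvPolynomial.X : σ → MvPolynomial σ k))) :
    G.IsMinimalGradedResolution I := by
  classical
  let ε : (G.gens 0 → MvPolynomial σ k) →ₗ[MvPolynomial σ k] MvPolynomial σ k :=
    Fintype.linearCombination (MvPolynomial σ k) fun b => e (φ 0 b)
  have ε_apply : ∀ v, ε v = ∑ b, v b * e (φ 0 b) := fun v => rfl
  have hdot : ∀ v : X → MvPolynomial σ k, e ⬝ᵥ v = ε (v ∘ φ 0) := fun v => by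
    rw [hφ.dotProduct_eq h.aug_deg, ε_apply]
    exact Finset.sum_congr rfl fun x _ => mul_comm _ _
  have hlift : ∀ u (w : G.gens u → MvPolynomial σ k), ∃ v : X → MvPolynomial σ k,
      v ∘ φ u = w ∧ ∀ u', u' ≠ u → v ∘ φ u' = 0 := fun u w => by
    obtain ⟨v, hv⟩ := hφ.exists_eq fun u' => if hu : u' = u then hu ▸ w else 0
    exact ⟨v, by simp [hv], fun u' hu => by simp [hv, hu]⟩
  refine ⟨fun u m v hv => isHomogeneousVec_mulVec (hdeg u) hv, ?_, fun u => ?_,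
    ε, fun m v hv => ?_, ?_, ?_⟩
  · rintro u _ ⟨v, rfl⟩
    refine mem_smul_top_pi_iff.2 fun b => ?_
    exact sum_mem fun c _ => Ideal.mul_mem_right _ _ (hmin u b c)
  · ext w
    constructor
    · rintro ⟨w, rfl⟩
      obtain ⟨v, rfl, -⟩ := hlift _ w
      rw [LinearMap.mem_ker, ← hφ.mulVec_apply, ← hφ.mulVec_apply, h.mat_mulVec]
      rfl
    · intro hw
      obtain ⟨v, rfl, hv⟩ := hlift _ w
      obtain ⟨v', rfl⟩ := h.exact v (hφ.ext fun u' => by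
        rw [hφ.mulVec_apply]
        by_cases hu : u' = u
        · subst hu
          exact hw
        · rw [hv _ (by omega), map_zero]
          rfl) (by rw [hdot, hv 0 (by omega), map_zero])
      exact ⟨v' ∘ φ (u + 1 + 1), (hφ.mulVec_apply _ _).symm⟩
  · rw [ε_apply]
    refine IsHomogeneous.sum _ _ _ fun b _ => ?_
    by_cases h0 : v b = 0
    · rw [h0, zero_mul]
      exact isHomogeneous_zero _ _ _
    · obtain ⟨s, hs⟩ := support_nonempty.2 h0
      have hm := hv b s hs
      rw [← hm]
      refine IsHomogeneous.mul ?_ (he b)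
      intro s' hs'
      have := hv b s' (mem_support_iff.2 hs')
      have hdeg' : Finsupp.weight (1 : σ → ℕ) s' = s'.degree :=
        (DFunLike.congr_fun Finsupp.degree_eq_weight_one s').symm
      exact hdeg'.trans (by omega)
  · ext f
    rw [← hI, Ideal.mem_span_range_iff_exists_fun, LinearMap.mem_range]
    constructor
    · rintro ⟨w, rfl⟩
      obtain ⟨v, rfl, -⟩ := hlift _ w
      refine ⟨v, ?_⟩
      rw [← hdot, dotProduct]
      exact Finset.sum_congr rfl fun x _ => mul_comm _ _
    · rintro ⟨c, hc⟩
      refine ⟨c ∘ φ 0, ?_⟩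
      rw [← hdot, ← hc, dotProduct]
      exact Finset.sum_congr rfl fun x _ => mul_comm _ _
  · ext w
    constructor
    · intro hw
      obtain ⟨v, rfl, hv⟩ := hlift _ w
      obtain ⟨v', rfl⟩ := h.exact v (hφ.ext fun u' => by
        rw [hφ.mulVec_apply, hv _ (by omega), map_zero]
        rfl) (by rw [hdot]; exact hw)
      exact ⟨v' ∘ φ 1, (hφ.mulVec_apply _ _).symm⟩
    · rintro ⟨w, rfl⟩
      obtain ⟨v, rfl, -⟩ := hlift _ w
      rw [LinearMap.mem_ker, ← hφ.mulVec_apply, ← hdot, h.aug_mulVec]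

end IsTotalization

theorem isTotalization_sigma (G : GradedFreeSeq σ k) :
    G.IsTotalization (X := Σ u, G.gens u) (fun x => x.1) G.entry fun u b => ⟨u, b⟩ where
  injective _ := sigma_mk_injective
  deg_eq _ _ := rfl
  surjective := by
    rintro _ ⟨u, b⟩ rfl
    exact ⟨b, rfl⟩
  mat_eq := entry_succ
  mat_deg _ _ := entry_ne_zero

/-! ### The tensor product -/

section Tensor

variable {t : ℕ} (F : Fin t → GradedFreeSeq σ k)

theorem tensor_mat (i : ℕ) (b : (tensor F).gens i) (c : (tensor F).gens (i + 1)) :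
    (tensor F).mat i b c =
      totalMat (X := fun j => Σ u, (F j).gens u) (fun _ x => x.1) (fun j => (F j).entry)
        (fun a => ⟨b.1.1 a, b.2 a⟩) (fun a => ⟨c.1.1 a, c.2 a⟩) := by
  simp only [totalMat, tensor]
  refine Finset.sum_congr rfl fun j _ => ?_
  congr

theorem isTotalization_tensor :
    (tensor F).IsTotalization (X := ∀ j, Σ u, (F j).gens u) (fun x => ∑ j, (x j).1)
      (totalMat (fun _ x => x.1) fun j => (F j).entry) fun _ b a => ⟨b.1.1 a, b.2 a⟩ where
  injective i := by
    rintro ⟨⟨u, hu⟩, b⟩ ⟨⟨w, hw⟩, c⟩ h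
    have h1 : u = w := funext fun a => congrArg Sigma.fst (congrFun h a)
    subst h1
    have h2 : b = c := funext fun a => sigma_mk_injective (congrFun h a)
    rw [h2]
  deg_eq i b := (Finset.mem_piAntidiag.1 b.1.2).1
  surjective i x hx :=
    ⟨⟨⟨fun a => (x a).1, Finset.mem_piAntidiag.2 ⟨hx, fun _ _ => Finset.mem_univ _⟩⟩,
      fun a => (x a).2⟩, rfl⟩
  mat_eq i b c := (tensor_mat F i b c).symm
  mat_deg x y h := by
    classical
    obtain ⟨j, -, hj⟩ := Finset.exists_ne_zero_of_sum_ne_zero h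
    have hxy : ∀ a, a ≠ j → x a = y a := by
      by_contra hxy
      exact hj (if_neg hxy)
    rw [if_pos hxy] at hj
    have := entry_ne_zero (right_ne_zero_of_mul hj)
    have hsum : ∑ a ∈ {j}ᶜ, (x a).1 = ∑ a ∈ {j}ᶜ, (y a).1 :=
      Finset.sum_congr rfl fun a ha => by rw [hxy a (by simpa using ha)]
    rw [Fintype.sum_eq_add_sum_compl j, Fintype.sum_eq_add_sum_compl j (fun j => (x j).1), this,
      hsum]
    omega

variable {F}

theorem degree_totalMat {I : Fin t → Ideal (MvPolynomial σ k)}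
    (h : ∀ j, (F j).IsMinimalGradedResolution (I j)) (x y : ∀ j, Σ u, (F j).gens u) :
    ∀ s ∈ (totalMat (fun _ x => x.1) (fun j => (F j).entry) x y).support,
      s.degree + ∑ j, (F j).deg (x j).1 (x j).2 = ∑ j, (F j).deg (y j).1 (y j).2 := by
  classical
  intro s hs
  obtain ⟨j, -, hj⟩ := mem_support_sum_exists hs
  split_ifs at hj with hxy
  · have hs' : s ∈ ((F j).entry (x j) (y j)).support := by
      rcases neg_one_pow_eq_or (MvPolynomial σ k)
        (∑ a ∈ Finset.univ.filter (fun a => a < j), (y a).1) with h1 | h1 <;>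
      simpa [h1] using hj
    have := (h j).degree_entry _ _ s hs'
    have hsum : ∑ a ∈ {j}ᶜ, (F a).deg (x a).1 (x a).2 = ∑ a ∈ {j}ᶜ, (F a).deg (y a).1 (y a).2 :=
      Finset.sum_congr rfl fun a ha => by rw [hxy a (by simpa using ha)]
    rw [Fintype.sum_eq_add_sum_compl j,
      Fintype.sum_eq_add_sum_compl j (fun j => (F j).deg (y j).1 (y j).2), ← this, hsum]
    omega
  · simp at hj

theorem totalMat_mem {I : Fin t → Ideal (MvPolynomial σ k)}
    (h : ∀ j, (F j).IsMinimalGradedResolution (I j)) (x y : ∀ j, Σ u, (F j).gens u) :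
    totalMat (fun _ x => x.1) (fun j => (F j).entry) x y ∈
      Ideal.span (Set.range (X : σ → MvPolynomial σ k)) := by
  refine sum_mem fun j _ => ?_
  split_ifs
  · exact Ideal.mul_mem_left _ _ ((h j).entry_mem _ _)
  · exact zero_mem _

/-- The tensor product of finite minimal graded resolutions of monomial ideals in pairwise disjoint
sets of variables is a minimal graded resolution of the product of the ideals. -/
theorem IsMinimalGradedResolution.tensor {I : Fin t → Ideal (MvPolynomial σ k)}
    (h : ∀ j, (F j).IsMinimalGradedResolution (I j)) (hfin : ∀ j, Finite (Σ u, (F j).gens u))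
    (V : Fin t → Set σ) (hV : Pairwise fun i j => Disjoint (V i) (V j))
    (T : Fin t → Set (σ →₀ ℕ)) (hT : ∀ j, ∀ m ∈ T j, (m.support : Set σ) ⊆ V j)
    (hI : ∀ j, I j = Ideal.span ((fun m => monomial m (1 : k)) '' T j)) :
    (tensor F).IsMinimalGradedResolution (∏ j, I j) := by
  classical
  have := fun j => Fintype.ofFinite (Σ u, (F j).gens u)
  choose e he heI hedeg using fun j => (F j).isTotalization_sigma.exists_isFreeResolution (h j)
  refine (isTotalization_tensor F).isMinimalGradedResolution
    (isFreeResolution_totalMat he V hV T hT fun j => (heI j).trans (hI j)) ?_ (fun b => ?_)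
    (fun u b c => ?_) fun u b c => ?_
  · rw [span_range_prod]
    exact Finset.prod_congr rfl fun j _ => heI j
  · exact IsHomogeneous.prod _ _ _ fun j _ => hedeg j _ _
  · rw [tensor_mat]
    exact degree_totalMat h _ _
  · rw [tensor_mat]
    exact totalMat_mem h _ _

theorem HasLinearShape.tensor {r l : Fin t → ℕ} {n : Fin t → ℕ → ℕ}
    (h : ∀ j, (F j).HasLinearShape (r j) (l j) (n j)) :
    (tensor F).HasLinearShape (∑ j, r j) (∑ j, l j)
      fun i => ∑ u ∈ Finset.piAntidiag (Finset.univ : Finset (Fin t)) i, ∏ j, n j (u j) where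
  rank_eq i := by
    change Fintype.card ((u : ↥(Finset.piAntidiag (Finset.univ : Finset (Fin t)) i)) ×
      (∀ j, (F j).gens (u.1 j))) = _
    rw [Fintype.card_sigma]
    simp only [Fintype.card_pi, (h _).rank_eq]
    exact Finset.sum_coe_sort (Finset.piAntidiag (Finset.univ : Finset (Fin t)) i)
      fun u => ∏ j, n j (u j)
  deg_eq i b := by
    change ∑ j, (F j).deg (b.1.1 j) (b.2 j) = _
    simp only [(h _).deg_eq, Finset.sum_add_distrib]
    rw [(Finset.mem_piAntidiag.1 b.1.2).1]
  rank_zero i hi := by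
    refine Finset.sum_eq_zero fun u hu => ?_
    rw [← (Finset.mem_piAntidiag.1 hu).1] at hi
    obtain ⟨j, hj, hlt⟩ := Finset.exists_lt_of_sum_lt hi
    exact Finset.prod_eq_zero hj ((h j).rank_zero _ hlt)

end Tensor

end GradedFreeSeq

end GradedSequences

end MatroidFacet

/-- Let `B_1, …, B_t` be the blocks of a finite matroid `M`, and let `F_j` be an `ℕ`-graded minimal
free resolution of `S · F(B_j)` of the linear shape with ranks `n_{u,j}`, initial degree `r_j` and
last index `l_j`. Then the tensor product of the `F_j` is an `ℕ`-graded minimal free resolution of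
`F(M)` of the linear shape with ranks `∑_{u_1 + ⋯ + u_t = i} ∏_j n_{u_j,j}`, initial degree `∑ r_j`
and last index `∑ l_j`; the last rank is nonzero if the last rank of every `F_j` is. -/
theorem theorem3p2 {k : Type*} [Field k] {α : Type*} (M : Matroid α) [M.Finite]
    {t : ℕ} (B : Fin t → Set α)
    (hB : ∀ j, MatroidFacet.IsBlock M (B j))
    (hinj : Function.Injective B)
    (hall : ∀ X, MatroidFacet.IsBlock M X → ∃ j, B j = X)
    (r l : Fin t → ℕ) (n : Fin t → ℕ → ℕ)
    (F : Fin t → MatroidFacet.GradedFreeSeq M.E k)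
    (hres : ∀ j, (F j).IsMinimalGradedResolution
      (MatroidFacet.blockIdeal k M (hB j).subset_ground))
    (hlin : ∀ j, (F j).HasLinearShape (r j) (l j) (n j))
    (β : ℕ → ℕ)
    (hβ : ∀ i, β i =
      ∑ u ∈ Finset.piAntidiag (Finset.univ : Finset (Fin t)) i, ∏ j, n j (u j)) :
    (MatroidFacet.GradedFreeSeq.tensor F).IsMinimalGradedResolution
        (MatroidFacet.facetIdeal k M) ∧
      (MatroidFacet.GradedFreeSeq.tensor F).HasLinearShape (∑ j, r j) (∑ j, l j) β ∧
      ((∀ j, n j (l j) ≠ 0) → β (∑ j, l j) ≠ 0) := by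
  classical
  open MatroidFacet MatroidFacet.GradedFreeSeq in
  have hprod : facetIdeal k M = ∏ j, blockIdeal k M (hB j).subset_ground := by
    simp only [blockIdeal_eq_span]
    rw [prod_span_monomial, facetIdeal_eq_span, facetExponents_eq_sum hB hinj hall]
  obtain rfl : β = fun i =>
    ∑ u ∈ Finset.piAntidiag (Finset.univ : Finset (Fin t)) i, ∏ j, n j (u j) := funext hβ
  refine ⟨?_, MatroidFacet.GradedFreeSeq.HasLinearShape.tensor hlin, fun hn h0 => ?_⟩
  · rw [hprod]
    refine MatroidFacet.GradedFreeSeq.IsMinimalGradedResolution.tensor hres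
      (fun j => (hlin j).finite_sigma) (fun j => Subtype.val ⁻¹' B j) (fun i j hij => ?_) _
      (fun j m hm => MatroidFacet.support_subset_of_mem_facetExponents hm)
      fun j => MatroidFacet.blockIdeal_eq_span k M (hB j).subset_ground
    exact Set.disjoint_left.2 fun e hi hj => hij (hinj ((hB i).eq_of_mem (hB j) hi hj))
  · refine Finset.prod_ne_zero_iff.2 (fun j _ => hn j) (Finset.sum_eq_zero_iff.1 h0 l ?_)
    exact Finset.mem_piAntidiag.2 ⟨rfl, fun _ _ => Finset.mem_univ _⟩
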